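/- Let \(\mathbb K=\mathbb R\) or \(\mathbb C\), and let \(X\) be an infinite-dimensional separable Fréchet space over \(\mathbb K\) (in particular, \(X\) may be any infinite-dimensional separable Banach space). Let \(\mathcal L(X)\) be the space of continuous linear operators on \(X\), and \(\mathrm{GL}(X)\subset\mathcal L(X)\) the set of operators that have a continuous linear inverse. For a topological vector space \(Y\) and \(T\in\mathcal L(Y)\), let \(\Sigma(T)\) be the set of all \(g\in\mathcal L(Y)\) for which \[ \{y\in Y:\ \text{there is a strictly increasing sequence }(\omega_n)\text{ of positive integers with }T^{\omega_n}y\to g(y)\} \] is dense in \(Y\), and let \(\Omega(T)\) be the set of all \(h\in\mathcal L(Y)\) for which there is a strictly increasing sequence \((\omega_n)\) of positive integers such that \(\{y\in Y: T^{\omega_n}y\to h(y)\}\) is dense in \(Y\). The operator \(T\) is quasi-rigid if \(\mathrm{Id}\in\Omega(T)\). For \(T\in\mathcal L(X)\), a collection \(M\subset\mathcal L(X)\) is simultaneously approximated by \(T\) if for every \(m\in\mathbb N\) and all \(g_1,\dots,g_m\in M\) (repetitions allowed) one has \(g_1\oplus\cdots\oplus g_m\in\Sigma(T\oplus\cdots\oplus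 T)\), where the direct sums have \(m\) summands and act on \(X^m\). If \(T\) is quasi-rigid, there is a unique collection \(\mathcal G(T)\) that contains \(\mathrm{Id}\) and is maximal, with respect to inclusion, among the collections simultaneously approximated by \(T\) and contained in \(\Omega(T)\cap\mathrm{GL}(X)\). Then the set \[ \{T\in\mathcal L(X):\ T\text{ is quasi-rigid and }\{\mathrm{Id}\}\subsetneq\mathcal G(T)\subsetneq\mathrm{GL}(X)\} \] is dense in \(\mathcal L(X)\) for the strong operator topology (the topology of pointwise convergence on \(X\)). -/

import Mathlib

open Filter Topology

namespace QuasiRigidDensity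

section

variable {𝕜 : Type*} [RCLike 𝕜] {Y : Type*} [AddCommGroup Y] [Module 𝕜 Y] [TopologicalSpace Y]

/-- `R(T, g)`: the points `y` such that `T ^ ω n y → g y` for some strictly increasing sequence
`ω` of positive integers, which may depend on `y`. -/
def limitPoints (T g : Y →L[𝕜] Y) : Set Y :=
  {y | ∃ ω : ℕ → ℕ, StrictMono ω ∧ (∀ n, 0 < ω n) ∧
    Tendsto (fun n => (T ^ ω n) y) atTop (𝓝 (g y))}

/-- `Σ(T)`: the continuous linear operators `g` for which `R(T, g)` is dense. -/
def sigmaSet (T : Y →L[𝕜] Y) : Set (Y →L[𝕜] Y) :=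
  {g | Dense (limitPoints T g)}

/-- `Ω(T)`: the continuous linear operators `h` for which one strictly increasing sequence `ω` of
positive integers satisfies `T ^ ω n y → h y` for all `y` in a dense set. -/
def omegaSet (T : Y →L[𝕜] Y) : Set (Y →L[𝕜] Y) :=
  {h | ∃ ω : ℕ → ℕ, StrictMono ω ∧ (∀ n, 0 < ω n) ∧
    Dense {y | Tendsto (fun n => (T ^ ω n) y) atTop (𝓝 (h y))}}

/-- `T` is quasi-rigid: one strictly increasing sequence `θ` of positive integers satisfies
`T ^ θ n y → y` for all `y` in a dense set. -/
def IsQuasiRigid (T : Y →L[𝕜] Y) : Prop :=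
  ∃ θ : ℕ → ℕ, StrictMono θ ∧ (∀ n, 0 < θ n) ∧
    Dense {y | Tendsto (fun n => (T ^ θ n) y) atTop (𝓝 y)}

variable (𝕜 Y) in
/-- `GL(Y)`: the continuous linear operators with a continuous linear inverse. -/
def generalLinear : Set (Y →L[𝕜] Y) :=
  {h | h.IsInvertible}

/-- The collection `M` is simultaneously approximated by `T`: for all `m` and all `g₁, …, gₘ` in
`M` (repetitions allowed), the operator `g₁ ⊕ ⋯ ⊕ gₘ` on `Y ^ m` belongs to `Σ(T ⊕ ⋯ ⊕ T)`. -/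
def IsSimultaneouslyApproximated (T : Y →L[𝕜] Y) (M : Set (Y →L[𝕜] Y)) : Prop :=
  ∀ (m : ℕ) (g : Fin m → (Y →L[𝕜] Y)), (∀ i, g i ∈ M) →
    ContinuousLinearMap.piMap g ∈ sigmaSet (ContinuousLinearMap.piMap fun _ : Fin m => T)

/-- `M` is maximal, with respect to inclusion, among the collections simultaneously approximated by
`T` that are contained in `Ω(T) ∩ GL(Y)`. -/
def IsMaximalInvertibleCollection (T : Y →L[𝕜] Y) (M : Set (Y →L[𝕜] Y)) : Prop :=
  Maximal (fun N => IsSimultaneouslyApproximated T N ∧ N ⊆ omegaSet T ∩ generalLinear 𝕜 Y) M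

/-- `G = 𝒢(T)`: `G` is the unique maximal collection simultaneously approximated by `T`, contained
in `Ω(T) ∩ GL(Y)`, to which the identity operator belongs. -/
def IsIdentityCollection (T : Y →L[𝕜] Y) (G : Set (Y →L[𝕜] Y)) : Prop :=
  (IsMaximalInvertibleCollection T G ∧ ContinuousLinearMap.id 𝕜 Y ∈ G) ∧
    ∀ G' : Set (Y →L[𝕜] Y),
      IsMaximalInvertibleCollection T G' → ContinuousLinearMap.id 𝕜 Y ∈ G' → G' = G

/-- `A` is dense in `L(Y)` for the strong operator topology, which is the topology of pointwise
convergence on `Y`. -/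
def IsSOTDense [IsTopologicalAddGroup Y] [ContinuousConstSMul 𝕜 Y] (A : Set (Y →L[𝕜] Y)) : Prop :=
  Dense (X := Y →Lₚₜ[𝕜] Y)
    (ContinuousLinearMap.toUniformConvergenceCLM (RingHom.id 𝕜) Y {s : Set Y | Finite s} '' A)

end

end QuasiRigidDensity

/-! Fix a nonzero functional `φ` and suppose that `φ ∘ T = φ` and that `T` is mixing inside each
fibre of `φ`. By Baire category every `g` with `φ ∘ g = φ` is approximated by powers of `T`,
simultaneously with any others; conversely every element of `Ω(T)` preserves `φ`. Hence `𝒢(T)` is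
the stabilizer of `φ` in `GL(X)`, which is neither trivial nor everything.

Such a `T` is the identity plus a weighted backward shift along `x 1, x 2, …` of a biorthogonal
system, with `x 0` fixed and `φ = f 0`. On the span of the shifted vectors it is conjugate to the
translation `q(X) ↦ q(X + 1)` of polynomials, where Kitai's criterion can be checked by hand
(`exists_tendsto_translates`).

All conjugates of `T` have the same property, and the invertible operators act transitively on
finite independent families. So a conjugate can be made to interpolate prescribed values in general
position, which gives density. -/

namespace QuasiRigidDensity

/-! ### Mixing over a functional, Baire category and the collection `𝒢(T)`. -/

section Dynamics

variable {𝕜 : Type*} [RCLike 𝕜]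

section Baire

variable {W : Type*} [AddCommGroup W] [Module 𝕜 W] [TopologicalSpace W]

/-- Every point can be perturbed so that the `k`-th iterate of `S` is close to its image by `g`,
for all large `k`. -/
def IsApproximatelyReached (S g : W →L[𝕜] W) : Prop :=
  ∀ w, ∀ U ∈ 𝓝 w, ∀ V ∈ 𝓝 (g w), ∀ᶠ k in atTop, ∃ u ∈ U, (S ^ k) u ∈ V

variable [IsTopologicalAddGroup W] [FirstCountableTopology W]

theorem limitPoints_mem_residual {S g : W →L[𝕜] W} (h : IsApproximatelyReached S g) :
    limitPoints S g ∈ residual W := by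
  obtain ⟨b, hb⟩ := (𝓝 (0 : W)).exists_antitone_basis
  have hV : ∀ n, ∃ V : Set W, IsOpen V ∧ (0 : W) ∈ V ∧ V ⊆ b n := fun n => by
    obtain ⟨V, h1, h2, h3⟩ := mem_nhds_iff.1 (hb.1.mem_of_mem (i := n) trivial)
    exact ⟨V, h2, h3, h1⟩
  choose V hVo hV0 hVb using hV
  have hopen : ∀ n, IsOpen {w : W | ∃ k > n, (S ^ k) w - g w ∈ V n} := fun n => by
    have : {w : W | ∃ k > n, (S ^ k) w - g w ∈ V n}
        = ⋃ k > n, (fun w => (S ^ k) w - g w) ⁻¹' V n := by ext; simp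
    rw [this]
    exact isOpen_biUnion fun k _ => (hVo n).preimage (by fun_prop)
  have hdense : ∀ n, Dense {w : W | ∃ k > n, (S ^ k) w - g w ∈ V n} := fun n w => by
    rw [mem_closure_iff_nhds]
    intro U hU
    have hc : Tendsto (fun p : W × W => p.1 - g p.2) (𝓝 (g w) ×ˢ 𝓝 w) (𝓝 0) := by
      have : Continuous (fun p : W × W => p.1 - g p.2) := by fun_prop
      have := this.tendsto (g w, w)
      rwa [nhds_prod_eq, sub_self] at this
    have := hc ((hVo n).mem_nhds (hV0 n))
    obtain ⟨A, hA, B, hB, hAB⟩ := mem_prod_iff.1 (mem_map.1 this)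
    obtain ⟨k, ⟨u, hu, hku⟩, hk⟩ :=
      ((h w (U ∩ B) (inter_mem hU hB) A hA).and (eventually_gt_atTop n)).exists
    exact ⟨u, hu.1, k, hk, hAB (Set.mk_mem_prod hku hu.2)⟩
  have hres : (⋂ n, {w : W | ∃ k > n, (S ^ k) w - g w ∈ V n}) ∈ residual W :=
    countable_iInter_mem.2 fun n => residual_of_dense_open (hopen n) (hdense n)
  refine mem_of_superset hres fun w hw => ?_
  simp only [Set.mem_iInter, Set.mem_ofPred_eq] at hw
  choose k hk hkV using hw
  have hkt : Tendsto k atTop atTop :=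
    tendsto_atTop_mono (fun n => (hk n).le) tendsto_id
  obtain ⟨ψ, hψ, hkψ⟩ := strictMono_subseq_of_tendsto_atTop hkt
  refine ⟨k ∘ ψ, hkψ, fun n => (Nat.zero_le _).trans_lt (hk (ψ n)), ?_⟩
  have h0 : Tendsto (fun n => (S ^ k n) w - g w) atTop (𝓝 0) :=
    hb.tendsto fun n => hVb n (hkV n)
  simpa using (h0.comp hψ.tendsto_atTop).add_const (g w)

end Baire

section Pi

variable {X : Type*} [AddCommGroup X] [Module 𝕜 X] [TopologicalSpace X]

theorem piMap_pow_apply {ι : Type*} (T : X →L[𝕜] X) (k : ℕ) (y : ι → X) (i : ι) :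
    ((ContinuousLinearMap.piMap fun _ : ι => T) ^ k) y i = (T ^ k) (y i) := by
  induction k generalizing y with
  | zero => simp
  | succ k ih => simp [pow_succ, ih]

/-- Within each fibre of `φ`, every point can be perturbed so that its `k`-th iterate is close to
any given point of the fibre, for all large `k`. -/
def IsMixingOver (φ : X →L[𝕜] 𝕜) (T : X →L[𝕜] X) : Prop :=
  ∀ x y, φ x = φ y → ∀ U ∈ 𝓝 x, ∀ V ∈ 𝓝 y, ∀ᶠ k in atTop, ∃ u ∈ U, (T ^ k) u ∈ V

/-- A neighbourhood in a product constrains finitely many coordinates, and finitely many conditions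
valid for all large `k` hold together. Infinite `ι` is allowed, as needed for `Ω(T)`. -/
theorem IsMixingOver.isApproximatelyReached_piMap {φ : X →L[𝕜] 𝕜} {T : X →L[𝕜] X}
    (h : IsMixingOver φ T) {ι : Type*} (g : ι → X →L[𝕜] X) (hg : ∀ i x, φ (g i x) = φ x) :
    IsApproximatelyReached (ContinuousLinearMap.piMap fun _ : ι => T)
      (ContinuousLinearMap.piMap g) := by
  classical
  intro w U hU V hV
  rw [nhds_pi, Filter.mem_pi'] at hU hV
  obtain ⟨I, s, hs, hsU⟩ := hU
  obtain ⟨J, t, ht, htV⟩ := hV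
  have : ∀ᶠ k in atTop, ∀ i ∈ I ∪ J, ∃ u ∈ s i, (T ^ k) u ∈ t i :=
    (eventually_all_finset _).2 fun i _ => h _ _ (hg i (w i)).symm _ (hs i) _ (ht i)
  filter_upwards [this] with k hk
  choose! u hus hut using hk
  refine ⟨u, hsU fun i hi => hus i (by simp_all), htV fun i hi => ?_⟩
  rw [piMap_pow_apply]
  exact hut i (by simp_all)

theorem map_eq_of_mem_omegaSet {φ : X →L[𝕜] 𝕜} {T : X →L[𝕜] X} (hT : ∀ x, φ (T x) = φ x)
    {g : X →L[𝕜] X} (hg : g ∈ omegaSet T) (x : X) : φ (g x) = φ x := by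
  obtain ⟨ω, -, -, hd⟩ := hg
  have hpow : ∀ (k : ℕ) x, φ ((T ^ k) x) = φ x := fun k => by
    induction k with
    | zero => simp
    | succ k ih => intro x; rw [pow_succ, mul_apply_eq_comp, ih, hT]
  refine congrFun (Continuous.ext_on hd (f := fun x => φ (g x)) (by fun_prop) (by fun_prop)
    fun y hy => ?_) x
  have h1 := (φ.continuous.tendsto _).comp hy
  simp only [Function.comp_def, hpow] at h1
  exact tendsto_nhds_unique tendsto_const_nhds h1 |>.symm

end Pi

section Collection

variable {X : Type*} [AddCommGroup X] [Module 𝕜 X] [UniformSpace X] [IsUniformAddGroup X]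
  [(uniformity X).IsCountablyGenerated] [CompleteSpace X]

theorem IsMixingOver.isSimultaneouslyApproximated {φ : X →L[𝕜] 𝕜} {T : X →L[𝕜] X}
    (h : IsMixingOver φ T) {M : Set (X →L[𝕜] X)} (hM : ∀ g ∈ M, ∀ x, φ (g x) = φ x) :
    IsSimultaneouslyApproximated T M := fun _ g hg =>
  dense_of_mem_residual <| limitPoints_mem_residual <|
    h.isApproximatelyReached_piMap g fun i => hM _ (hg i)

theorem eventually_residual_denseRange (X : Type*) [TopologicalSpace X]
    [SecondCountableTopology X] : ∀ᶠ y in residual (ℕ → X), DenseRange y := by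
  have hres : (⋂ O ∈ TopologicalSpace.countableBasis X, ⋃ n, (fun y : ℕ → X => y n) ⁻¹' O)
      ∈ residual (ℕ → X) := by
    refine (countable_bInter_mem (TopologicalSpace.countable_countableBasis X)).2 fun O hO => ?_
    have hOo := TopologicalSpace.isOpen_of_mem_countableBasis hO
    obtain ⟨x, hx⟩ := TopologicalSpace.nonempty_of_mem_countableBasis hO
    refine residual_of_dense_open
      (isOpen_iUnion fun n => hOo.preimage (continuous_apply n)) fun y => ?_
    rw [mem_closure_iff_nhds]
    intro U hU
    rw [nhds_pi, Filter.mem_pi'] at hU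
    obtain ⟨I, s, hs, hsU⟩ := hU
    obtain ⟨n, hn⟩ := Infinite.exists_notMem_finset I
    refine ⟨Function.update y n x, hsU fun i hi => ?_, Set.mem_iUnion.2 ⟨n, by simpa using hx⟩⟩
    rw [Function.update_of_ne (by rintro rfl; exact hn hi)]
    exact mem_of_mem_nhds (hs i)
  filter_upwards [hres] with y hy
  refine (TopologicalSpace.isBasis_countableBasis X).dense_iff.2 fun O hO hne => ?_
  obtain ⟨n, hn⟩ := Set.mem_iUnion.1 (Set.mem_iInter₂.1 hy O hO)
  exact ⟨y n, hn, n, rfl⟩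

/-- A generic point of `X ^ ℕ` is a dense sequence and also a limit point for the infinite direct
sum, so one `ω` serves all its terms. -/
theorem IsMixingOver.mem_omegaSet [TopologicalSpace.SeparableSpace X] {φ : X →L[𝕜] 𝕜}
    {T : X →L[𝕜] X} (h : IsMixingOver φ T) {g : X →L[𝕜] X} (hg : ∀ x, φ (g x) = φ x) :
    g ∈ omegaSet T := by
  have : SecondCountableTopology X := UniformSpace.secondCountable_of_separable X
  have hlim := limitPoints_mem_residual
    (h.isApproximatelyReached_piMap (fun _ : ℕ => g) fun _ => hg)
  obtain ⟨y, ⟨ω, hω, hpos, hy⟩, hd⟩ :=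
    (dense_of_mem_residual (inter_mem hlim (eventually_residual_denseRange X))).nonempty
  refine ⟨ω, hω, hpos, hd.mono ?_⟩
  rintro _ ⟨n, rfl⟩
  have := (tendsto_pi_nhds.1 hy) n
  simp only [piMap_pow_apply] at this
  exact this

/-- The stabilizer of `φ` is itself admissible and contains every admissible collection, hence
maximality and uniqueness. -/
theorem IsMixingOver.isIdentityCollection [TopologicalSpace.SeparableSpace X] {φ : X →L[𝕜] 𝕜}
    {T : X →L[𝕜] X} (h : IsMixingOver φ T) (hT : ∀ x, φ (T x) = φ x) :
    IsIdentityCollection T {g | (∀ x, φ (g x) = φ x) ∧ g ∈ generalLinear 𝕜 X} := by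
  have hmem : IsSimultaneouslyApproximated T {g | (∀ x, φ (g x) = φ x) ∧ g ∈ generalLinear 𝕜 X} ∧
      {g | (∀ x, φ (g x) = φ x) ∧ g ∈ generalLinear 𝕜 X} ⊆ omegaSet T ∩ generalLinear 𝕜 X :=
    ⟨h.isSimultaneouslyApproximated fun g hg => hg.1,
      fun g hg => ⟨h.mem_omegaSet hg.1, hg.2⟩⟩
  have hle : ∀ N : Set (X →L[𝕜] X), N ⊆ omegaSet T ∩ generalLinear 𝕜 X →
      N ⊆ {g | (∀ x, φ (g x) = φ x) ∧ g ∈ generalLinear 𝕜 X} := fun N hN g hg =>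
    ⟨map_eq_of_mem_omegaSet hT (hN hg).1, (hN hg).2⟩
  refine ⟨⟨⟨hmem, fun N hN _ => hle N hN.2⟩, fun _ => rfl,
    ⟨ContinuousLinearEquiv.refl 𝕜 X, rfl⟩⟩, fun G hG _ => ?_⟩
  exact (hle G hG.prop.2).antisymm (hG.le_of_ge hmem (hle G hG.prop.2))

theorem IsMixingOver.exists_identityCollection [ContinuousSMul 𝕜 X]
    [TopologicalSpace.SeparableSpace X] {φ : X →L[𝕜] 𝕜}
    {T : X →L[𝕜] X} (h : IsMixingOver φ T) (hT : ∀ x, φ (T x) = φ x) {e z : X} (he : φ e = 1)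
    (hz : z ≠ 0) (hφz : φ z = 0) :
    IsQuasiRigid T ∧ ∃ G : Set (X →L[𝕜] X), IsIdentityCollection T G ∧
      {ContinuousLinearMap.id 𝕜 X} ⊂ G ∧ G ⊂ generalLinear 𝕜 X := by
  have hG := h.isIdentityCollection hT
  have hid := h.mem_omegaSet (g := ContinuousLinearMap.id 𝕜 X) fun _ => rfl
  refine ⟨hid, _, hG, ?_, ?_⟩
  · rw [Set.ssubset_iff_of_subset (Set.singleton_subset_iff.2 hG.1.2)]
    -- `D c` fixes `e` and multiplies the kernel of `φ` by `c`.
    let D (c : 𝕜) : X →L[𝕜] X :=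
      φ.smulRight e + c • (ContinuousLinearMap.id 𝕜 X - φ.smulRight e)
    have hD : ∀ c d : 𝕜, c * d = 1 → ∀ x, D c (D d x) = x := fun c d hcd x => by
      simp [D, he, smul_sub, smul_smul, ← mul_assoc, hcd]
    refine ⟨D 2, ⟨fun x => by simp [D, he], ⟨ContinuousLinearEquiv.equivOfInverse (D 2) (D 2⁻¹)
      (hD _ _ (by simp)) (hD _ _ (by simp)), rfl⟩⟩, fun hD2 => hz ?_⟩
    have := congrArg (fun L : X →L[𝕜] X => L z) (Set.mem_singleton_iff.1 hD2)
    simpa [D, hφz, two_smul] using this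
  · rw [Set.ssubset_iff_of_subset fun g hg => hg.2]
    refine ⟨(2 : 𝕜) • ContinuousLinearMap.id 𝕜 X,
      ⟨ContinuousLinearEquiv.smulLeft (Units.mk0 (2 : 𝕜) two_ne_zero), ?_⟩, fun hg => ?_⟩
    · ext x; simp [Units.smul_def]
    · have := hg.1 e
      simp [he] at this

end Collection

end Dynamics

/-! ### Translation of polynomials and Kitai's criterion. -/

section Polynomial

open Polynomial

variable {𝕜 : Type*} [RCLike 𝕜] {E : Type*} [AddCommGroup E] [Module 𝕜 E] [TopologicalSpace E]

theorem taylor_one_descPochhammer_succ (n : ℕ) : taylor 1 (descPochhammer 𝕜 (n + 1)) =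
    descPochhammer 𝕜 (n + 1) + ((n : 𝕜) + 1) • descPochhammer 𝕜 n := by
  have h := congrArg (taylor (1 : 𝕜)) (descPochhammer_succ_comp_X_sub_one 𝕜 n)
  have hc : ∀ p : 𝕜[X], taylor 1 (p.comp (X - 1)) = p := fun p => by
    rw [taylor_apply, comp_assoc]; simp
  rw [hc, map_sub, smul_eq_mul, taylor_mul, hc] at h
  rw [smul_eq_C_mul]
  simp only [map_add, map_natCast, taylor_one, C_1] at h ⊢
  have : taylor (1 : 𝕜) (n : 𝕜[X]) = n := by rw [← C_eq_natCast, taylor_C]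
  rw [this] at h
  linear_combination -h

/-- Along the basis of falling factorials, translation is the identity plus a backward shift. -/
theorem exists_linearMap_taylor {T : E →L[𝕜] E} (z : ℕ → E) (w : ℕ → 𝕜) (hw : ∀ n, w n ≠ 0)
    (h0 : T (z 0) = z 0) (hT : ∀ n, T (z (n + 1)) = z (n + 1) + w n • z n) :
    ∃ Φ : 𝕜[X] →ₗ[𝕜] E, (∀ q, T (Φ q) = Φ (taylor 1 q)) ∧
      (Submodule.span 𝕜 (Set.range z) : Set E) ⊆ Set.range Φ := by
  let S : Polynomial.Sequence 𝕜 := ⟨descPochhammer 𝕜, fun n => by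
    rw [degree_eq_natDegree (monic_descPochhammer 𝕜 n).ne_zero, descPochhammer_natDegree]⟩
  have hS : ∀ n, S n = descPochhammer 𝕜 n := fun _ => rfl
  let b := S.basis fun n => by simp [hS, (monic_descPochhammer 𝕜 n).leadingCoeff]
  have hb : ∀ n, b n = descPochhammer 𝕜 n := fun n => Sequence.basis_eq_self ..
  -- Rescaling for which `γ (n + 1) * w n = (n + 1) * γ n`, turning the weights of the shift into
  -- those of the forward difference.
  let γ : ℕ → 𝕜 := fun n => Nat.rec 1 (fun n c => (n + 1) * c / w n) n
  have hγ : ∀ n, γ (n + 1) = (n + 1) * γ n / w n := fun _ => rfl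
  have hγ0 : ∀ n, γ n ≠ 0 := fun n => by
    induction n with
    | zero => exact one_ne_zero
    | succ n ih =>
      rw [hγ]
      exact div_ne_zero (mul_ne_zero (by exact_mod_cast n.succ_ne_zero) ih) (hw n)
  let Φ := b.constr 𝕜 fun n => γ n • z n
  have hΦ : ∀ n, Φ (descPochhammer 𝕜 n) = γ n • z n := fun n => by
    rw [← hb]; exact b.constr_basis ..
  refine ⟨Φ, fun q => ?_, ?_⟩
  · have : T.toLinearMap ∘ₗ Φ = Φ ∘ₗ taylor 1 := b.ext fun n => by
      simp only [LinearMap.comp_apply, ContinuousLinearMap.coe_coe, hb]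
      cases n with
      | zero =>
        rw [hΦ, map_smul, h0, descPochhammer_zero, taylor_one, C_1, ← descPochhammer_zero, hΦ]
      | succ n =>
        rw [taylor_one_descPochhammer_succ, map_add, map_smul, hΦ, hΦ, map_smul, hT, smul_add,
          smul_smul, smul_smul, hγ, div_mul_cancel₀ _ (hw n)]
    exact LinearMap.congr_fun this q
  · rw [← LinearMap.coe_range, SetLike.coe_subset_coe, Submodule.span_le]
    rintro _ ⟨n, rfl⟩
    exact ⟨(γ n)⁻¹ • descPochhammer 𝕜 n, by
      rw [map_smul, hΦ, smul_smul, inv_mul_cancel₀ (hγ0 n), one_smul]⟩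

variable [IsTopologicalAddGroup E] [ContinuousSMul 𝕜 E]

/-- No continuity of `Φ` is needed: along a family polynomial in `t`, its values form a polynomial
in `t` with coefficients in `E`. -/
theorem tendsto_map_eval_C_inv (Φ : 𝕜[X] →ₗ[𝕜] E) (F : 𝕜[X][X]) :
    Tendsto (fun k : ℕ => Φ (F.eval (C (k : 𝕜)⁻¹))) atTop (𝓝 (Φ (F.eval 0))) := by
  have hc : Continuous fun t : 𝕜 => Φ (F.eval (C t)) := by
    have : (fun t : 𝕜 => Φ (F.eval (C t))) =
        fun t => ∑ i ∈ Finset.range (F.natDegree + 1), t ^ i • Φ (F.coeff i) := by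
      ext t
      rw [eval_eq_sum_range, map_sum]
      refine Finset.sum_congr rfl fun i _ => ?_
      rw [← C_pow, mul_comm, ← smul_eq_C_mul, map_smul]
    rw [this]
    fun_prop
  have := (hc.tendsto 0).comp (tendsto_inv_atTop_nhds_zero_nat (𝕜 := 𝕜))
  simpa [Function.comp_def] using this

/-- The two halves of the Kitai criterion for the translation operator on polynomials. -/
theorem exists_tendsto_translates (Φ : 𝕜[X] →ₗ[𝕜] E) (q : 𝕜[X]) :
    (∃ r : ℕ → 𝕜[X], Tendsto (fun k => Φ (r k)) atTop (𝓝 (Φ q)) ∧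
      Tendsto (fun k : ℕ => Φ (taylor (k : 𝕜) (r k))) atTop (𝓝 0)) ∧
    ∃ s : ℕ → 𝕜[X], Tendsto (fun k => Φ (s k)) atTop (𝓝 0) ∧
      Tendsto (fun k : ℕ => Φ (taylor (k : 𝕜) (s k))) atTop (𝓝 (Φ q)) := by
  induction q using Polynomial.induction_on' with
  | add p q hp hq =>
    obtain ⟨⟨r, hr, hr'⟩, s, hs, hs'⟩ := hp
    obtain ⟨⟨r₂, hr₂, hr₂'⟩, s₂, hs₂, hs₂'⟩ := hq
    refine ⟨⟨r + r₂, ?_, ?_⟩, s + s₂, ?_, ?_⟩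
    · simpa using hr.add hr₂
    · simpa using hr'.add hr₂'
    · simpa using hs.add hs₂
    · simpa using hs'.add hs₂'
  | monomial a c =>
    have hk : ∀ᶠ k : ℕ in atTop, (C (k : 𝕜) : 𝕜[X]) * C (k : 𝕜)⁻¹ = 1 := by
      filter_upwards [eventually_gt_atTop 0] with k hk
      rw [← C_mul, mul_inv_cancel₀ (by exact_mod_cast hk.ne'), C_1]
    -- The factor `(1 - X/k) ^ (a + 1)` tends to `1`, and translation by `k` turns it into `(-X/k) ^
    -- (a + 1)`. The exponent `a + 1` beats the growth of `(X + k) ^ a` by one power of `k`. The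
    -- second family uses the same estimate backwards.
    refine ⟨⟨fun k => C c * (X ^ a * (1 - C (k : 𝕜)⁻¹ * X) ^ (a + 1)), ?_, ?_⟩,
      fun k => C c * ((X - C (k : 𝕜)) ^ a * (C (k : 𝕜)⁻¹ * X) ^ (a + 1)), ?_, ?_⟩
    · have := tendsto_map_eval_C_inv Φ (C (C c) * (C (X ^ a) * (1 - X * C X) ^ (a + 1)))
      simpa [← C_mul_X_pow_eq_monomial] using this
    · have := tendsto_map_eval_C_inv Φ
        (C (C c) * ((X * C X + 1) ^ a * (-C (X : 𝕜[X])) ^ (a + 1) * X))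
      refine Tendsto.congr' ?_ (by simpa using this)
      filter_upwards [hk] with k hk
      congr 1
      simp only [taylor_mul, taylor_pow, taylor_C, taylor_X, map_sub, taylor_one]
      have h1 : (1 : 𝕜[X]) - C (k : 𝕜)⁻¹ * (X + C (k : 𝕜)) = - (C (k : 𝕜)⁻¹ * X) := by
        linear_combination -hk
      have h2 : (C (k : 𝕜)⁻¹ * X + 1 : 𝕜[X]) = C (k : 𝕜)⁻¹ * (X + C (k : 𝕜)) := by
        linear_combination -hk
      rw [C_1, h1, h2, mul_pow, ← mul_neg, mul_pow]
      ring
    · have := tendsto_map_eval_C_inv Φ (C (C c) * ((X * C X - 1) ^ a * C X ^ (a + 1) * X))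
      refine Tendsto.congr' ?_ (by simpa using this)
      filter_upwards [hk] with k hk
      congr 1
      have h2 : (C (k : 𝕜)⁻¹ * X - 1 : 𝕜[X]) = C (k : 𝕜)⁻¹ * (X - C (k : 𝕜)) := by
        linear_combination hk
      rw [h2, mul_pow, mul_pow]
      ring
    · have := tendsto_map_eval_C_inv Φ (C (C c) * (C (X ^ a) * (X * C X + 1) ^ (a + 1)))
      refine Tendsto.congr' ?_ (by simpa [← C_mul_X_pow_eq_monomial] using this)
      filter_upwards [hk] with k hk
      congr 1
      simp only [taylor_mul, taylor_pow, taylor_C, taylor_X, map_sub]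
      have h2 : (C (k : 𝕜)⁻¹ * X + 1 : 𝕜[X]) = C (k : 𝕜)⁻¹ * (X + C (k : 𝕜)) := by
        linear_combination -hk
      rw [h2]
      ring

/-- Points of one fibre share the component `φ x • e`, which `T` fixes; the Kitai sequences connect
their components in the kernel of `φ`. -/
theorem isMixingOver_of_taylor {φ : E →L[𝕜] 𝕜} {T : E →L[𝕜] E} {e : E} (he : φ e = 1)
    (hTe : T e = e) (Φ : 𝕜[X] →ₗ[𝕜] E) (hΦ : ∀ q, T (Φ q) = Φ (taylor 1 q))
    (hd : ∀ x, φ x = 0 → x ∈ closure (Set.range Φ)) : IsMixingOver φ T := by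
  have hpow : ∀ (k : ℕ) q, (T ^ k) (Φ q) = Φ (taylor (k : 𝕜) q) := fun k => by
    induction k with
    | zero => simp
    | succ k ih =>
      intro q
      rw [pow_succ, mul_apply_eq_comp, hΦ, ih, taylor_taylor, Nat.cast_succ]
  have hpe : ∀ k : ℕ, (T ^ k) e = e := fun k => by
    induction k with
    | zero => simp
    | succ k ih => rw [pow_succ, mul_apply_eq_comp, hTe, ih]
  have happrox : ∀ x, ∀ U ∈ 𝓝 x, ∃ q, φ x • e + Φ q ∈ U := fun x U hU => by
    have hx := hd (x - φ x • e) (by simp [he])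
    have hU' : (fun z => φ x • e + z) ⁻¹' U ∈ 𝓝 (x - φ x • e) :=
      (by fun_prop : Continuous fun z => φ x • e + z).continuousAt.preimage_mem_nhds (by simpa)
    obtain ⟨_, hz, q, rfl⟩ := mem_closure_iff_nhds.1 hx _ hU'
    exact ⟨q, hz⟩
  intro x y hxy U hU V hV
  obtain ⟨p, hp⟩ := happrox x _ (interior_mem_nhds.2 hU)
  obtain ⟨q, hq⟩ := happrox y _ (interior_mem_nhds.2 hV)
  obtain ⟨⟨r, hr, hr'⟩, -⟩ := exists_tendsto_translates Φ p
  obtain ⟨-, s, hs, hs'⟩ := exists_tendsto_translates Φ q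
  have h1 : Tendsto (fun k => φ x • e + (Φ (r k) + Φ (s k))) atTop (𝓝 (φ x • e + Φ p)) := by
    simpa using (hr.add hs).const_add (φ x • e)
  have h2 : Tendsto (fun k => (T ^ k) (φ x • e + (Φ (r k) + Φ (s k)))) atTop
      (𝓝 (φ y • e + Φ q)) := by
    simpa only [map_add, map_smul, hpow, hpe, hxy, zero_add] using (hr'.add hs').const_add (φ y • e)
  filter_upwards [h1 (isOpen_interior.mem_nhds hp), h2 (isOpen_interior.mem_nhds hq)]
    with k hk1 hk2
  exact ⟨_, interior_subset hk1, interior_subset hk2⟩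

end Polynomial

/-! ### Biorthogonal systems adapted to a sequence of seminorms. -/

section Biorthogonal

variable {𝕜 : Type*} [RCLike 𝕜] {X : Type*} [AddCommGroup X] [Module 𝕜 X] [TopologicalSpace X]

theorem exists_functional_eq_one_of_seminorm_ne_zero [PolynormableSpace 𝕜 X] {p : Seminorm 𝕜 X}
    (hp : Continuous p) {x : X} (hx : p x ≠ 0) :
    ∃ f : X →L[𝕜] 𝕜, f x = 1 ∧ ∃ C : ℝ, ∀ y, ‖f y‖ ≤ C * p y := by
  have hx0 : x ≠ 0 := by rintro rfl; simp at hx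
  let e := LinearEquiv.toSpanNonzeroSingleton 𝕜 X x hx0
  let c : NNReal := ⟨(p x)⁻¹, by positivity⟩
  have hc : Continuous (c • p) := by
    change Continuous fun y => c • p y
    exact hp.const_smul c
  obtain ⟨g, hg, hgp⟩ := Module.Dual.exists_continuous_extension_of_le_seminorm
    (Submodule.span 𝕜 {x}) e.symm.toLinearMap (p := c • p) hc fun y => by
      obtain ⟨a, rfl⟩ := e.surjective y
      change ‖e.symm (e a)‖ ≤ (p x)⁻¹ * p (a • x)
      rw [e.symm_apply_apply, map_smul_eq_mul, mul_comm, mul_assoc, mul_inv_cancel₀ hx, mul_one]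
  refine ⟨g, ?_, (p x)⁻¹, fun y => hgp y⟩
  have := (hg (e 1)).trans (e.symm_apply_apply 1)
  change g ((1 : 𝕜) • x) = 1 at this
  rwa [one_smul] at this

/-- An increasing sequence of continuous seminorms which defines the topology. -/
structure IsFundamentalSequence (p : ℕ → Seminorm 𝕜 X) : Prop where
  monotone : Monotone p
  continuous : ∀ n, Continuous (p n)
  exists_ball_subset : ∀ V ∈ 𝓝 (0 : X), ∃ n, (p n).ball 0 1 ⊆ V

theorem exists_isFundamentalSequence [IsTopologicalAddGroup X] [FirstCountableTopology X]
    [PolynormableSpace 𝕜 X] : ∃ p : ℕ → Seminorm 𝕜 X, IsFundamentalSequence p := by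
  obtain ⟨b, hb⟩ := (𝓝 (0 : X)).exists_antitone_basis
  have hq : ∀ n, ∃ q : Seminorm 𝕜 X, Continuous q ∧ q.ball 0 1 ⊆ b n := fun n => by
    obtain ⟨⟨s, r⟩, hr, hs⟩ := (PolynormableSpace.withSeminorms 𝕜 X).hasBasis_zero_ball.mem_iff.1
      (hb.1.mem_of_mem (i := n) trivial)
    let c : NNReal := ⟨r⁻¹, by positivity⟩
    refine ⟨c • s.sup fun p : {p : Seminorm 𝕜 X // Continuous p} => p.1, ?_, fun y hy => hs ?_⟩
    · exact (Seminorm.continuous_finsetSup fun a _ => a.2).const_smul c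
    · rw [Seminorm.mem_ball_zero] at hy ⊢
      change r⁻¹ * _ < 1 at hy
      rwa [inv_mul_lt_one₀ hr] at hy
  choose q hqc hqb using hq
  refine ⟨partialSups q, (partialSups q).monotone, fun n => ?_, fun V hV => ?_⟩
  · induction n with
    | zero => simpa using hqc 0
    | succ n ih =>
      rw [← Order.succ_eq_add_one, partialSups_succ]
      exact ih.sup (hqc _)
  · obtain ⟨n, -, hn⟩ := hb.1.mem_iff.1 hV
    exact ⟨n, (Seminorm.ball_antitone (le_partialSups q n)).trans ((hqb n).trans hn)⟩

theorem IsFundamentalSequence.exists_ne_zero [T2Space X] {p : ℕ → Seminorm 𝕜 X}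
    (hp : IsFundamentalSequence p) {x : X} (hx : x ≠ 0) : ∃ n, p n x ≠ 0 := by
  obtain ⟨n, hn⟩ := hp.exists_ball_subset _ (isOpen_compl_singleton.mem_nhds hx.symm)
  refine ⟨n, fun h => ?_⟩
  have : x ∈ (p n).ball 0 1 := by simp [h]
  simpa using hn this

variable [IsTopologicalAddGroup X] [ContinuousSMul 𝕜 X] [T2Space X] [PolynormableSpace 𝕜 X]

/-- The index `j` is the least one for which `p j` does not vanish on the range of `1 - P`. The
seminorms may all have kernels, so both the vanishing below `j` and the control by `p j` must be
recorded. -/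
theorem exists_biorthogonal_step (hX : ¬ FiniteDimensional 𝕜 X) {p : ℕ → Seminorm 𝕜 X}
    (hp : IsFundamentalSequence p) {P : X →L[𝕜] X}
    (hfin : ∃ S : Submodule 𝕜 X, FiniteDimensional 𝕜 S ∧ ∀ y, P y ∈ S) (hP : ∀ y, P (P y) = P y)
    {O : Set X} (hO : IsOpen O) (hne : O.Nonempty) :
    ∃ (c : X) (f : X →L[𝕜] 𝕜) (j : ℕ), c ∈ O ∧ f (c - P c) = 1 ∧ (∀ y, f (P y) = 0) ∧
      (∀ i < j, ∀ y, p i (y - P y) = 0) ∧ ∃ C : ℝ, ∀ y, ‖f y‖ ≤ C * p j (y - P y) := by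
  classical
  have hex : ∃ j v, p j (v - P v) ≠ 0 := by
    by_contra! h
    obtain ⟨S, hS, hPS⟩ := hfin
    refine hX (Module.finite_def.2 ?_)
    have : S = ⊤ := eq_top_iff.2 fun y _ => by
      have : y - P y = 0 := by
        by_contra hy
        obtain ⟨n, hn⟩ := hp.exists_ne_zero hy
        exact hn (h n y)
      rw [sub_eq_zero.1 this]
      exact hPS y
    rw [← this]
    exact Module.Finite.iff_fg.1 hS
  obtain ⟨v, hv⟩ := Nat.find_spec hex
  have hmin : ∀ i < Nat.find hex, ∀ y, p i (y - P y) = 0 := fun i hi y => by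
    by_contra h
    exact Nat.find_min hex hi ⟨y, h⟩
  set j := Nat.find hex
  have hc : ∃ c ∈ O, p j (c - P c) ≠ 0 := by
    obtain ⟨o, ho⟩ := hne
    by_cases h : p j (o - P o) = 0
    · have ht : Tendsto (fun ε : 𝕜 => o + ε • v) (𝓝[≠] 0) (𝓝 o) := by
        have : Continuous fun ε : 𝕜 => o + ε • v := by fun_prop
        simpa using (this.tendsto 0).mono_left nhdsWithin_le_nhds
      obtain ⟨ε, hε, hε0⟩ :=
        ((ht.eventually (hO.mem_nhds ho)).and self_mem_nhdsWithin).exists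
      refine ⟨_, hε, fun h0 => ?_⟩
      have : ε • (v - P v) = (o + ε • v - P (o + ε • v)) - (o - P o) := by
        rw [map_add, map_smul, smul_sub]; abel
      have hle := map_sub_le_add (p j) (o + ε • v - P (o + ε • v)) (o - P o)
      rw [← this, h0, h, map_smul_eq_mul, add_zero] at hle
      have : 0 < ‖ε‖ * p j (v - P v) := mul_pos (norm_pos_iff.2 hε0)
        ((apply_nonneg _ _).lt_of_ne hv.symm)
      linarith
    · exact ⟨o, ho, h⟩
  obtain ⟨c, hcO, hc⟩ := hc
  obtain ⟨f, hf, C, hC⟩ := exists_functional_eq_one_of_seminorm_ne_zero (hp.continuous j) hc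
  refine ⟨c, f - f.comp P, j, hcO, ?_, fun y => by simp [hP], hmin, C, fun y => ?_⟩
  · simp [hP, ← hf]
  · simpa using hC (y - P y)

/-- A biorthogonal system with dense span, and each `x n` is killed by all the seminorms of small
index with respect to those which control `f (n + 1)`. -/
theorem exists_biorthogonal [SecondCountableTopology X] (hX : ¬ FiniteDimensional 𝕜 X)
    {p : ℕ → Seminorm 𝕜 X} (hp : IsFundamentalSequence p) :
    ∃ (x : ℕ → X) (f : ℕ → X →L[𝕜] 𝕜), (∀ m, f m (x m) = 1) ∧ (∀ m n, m ≠ n → f m (x n) = 0) ∧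
      Dense (Submodule.span 𝕜 (Set.range x) : Set X) ∧
      ∀ i, ∃ l, ∀ n, p i (x n) = 0 ∨ ∃ C : ℝ, ∀ y, ‖f (n + 1) y‖ ≤ C * p l y := by
  have hO : ∃ O : ℕ → Set X, (∀ n, IsOpen (O n) ∧ (O n).Nonempty) ∧
      ∀ V, IsOpen V → V.Nonempty → ∃ n, O n ⊆ V := by
    have hcount := TopologicalSpace.countable_countableBasis X
    have hbasis := TopologicalSpace.isBasis_countableBasis X
    obtain ⟨U, hU, -⟩ := hbasis.exists_subset_of_mem_open (Set.mem_univ (0 : X)) isOpen_univ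
    obtain ⟨O, hO⟩ := hcount.exists_eq_range ⟨U, hU⟩
    have hmem : ∀ n, O n ∈ TopologicalSpace.countableBasis X := fun n => hO ▸ ⟨n, rfl⟩
    refine ⟨O, fun n => ⟨TopologicalSpace.isOpen_of_mem_countableBasis (hmem n),
      TopologicalSpace.nonempty_of_mem_countableBasis (hmem n)⟩, fun V hV ⟨v, hv⟩ => ?_⟩
    obtain ⟨U, hU, -, hUV⟩ := hbasis.exists_subset_of_mem_open hv hV
    obtain ⟨n, rfl⟩ := hO ▸ hU
    exact ⟨n, hUV⟩
  obtain ⟨O, hO, hOV⟩ := hO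
  let St := {P : X →L[𝕜] X // (∃ S : Submodule 𝕜 X, FiniteDimensional 𝕜 S ∧ ∀ y, P y ∈ S) ∧
    ∀ y, P (P y) = P y}
  have step := fun (P : St) (n : ℕ) =>
    exists_biorthogonal_step hX hp P.2.1 P.2.2 (hO n).1 (hO n).2
  choose c f j hcO hf1 hf0 hj hC using step
  have hnext : ∀ (P : St) (n : ℕ), (∃ S : Submodule 𝕜 X, FiniteDimensional 𝕜 S ∧
      ∀ y, (P.1 + (f P n).smulRight (c P n - P.1 (c P n))) y ∈ S) ∧
      ∀ y, (P.1 + (f P n).smulRight (c P n - P.1 (c P n)))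
        ((P.1 + (f P n).smulRight (c P n - P.1 (c P n))) y) =
        (P.1 + (f P n).smulRight (c P n - P.1 (c P n))) y := fun P n => by
    obtain ⟨S, hS, hPS⟩ := P.2.1
    refine ⟨⟨S ⊔ Submodule.span 𝕜 {c P n - P.1 (c P n)}, inferInstance, fun y => ?_⟩, fun y => ?_⟩
    · exact Submodule.add_mem_sup (hPS y)
        (Submodule.smul_mem _ _ (Submodule.mem_span_singleton_self _))
    · have h1 := hf1 P n
      rw [map_sub, hf0, sub_zero] at h1
      simp [P.2.2, hf0, h1]
  let Q : ℕ → St := fun n => Nat.rec ⟨0, ⟨⊥, inferInstance, by simp⟩, by simp⟩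
    (fun n P => ⟨P.1 + (f P n).smulRight (c P n - P.1 (c P n)), hnext P n⟩) n
  let P : ℕ → X →L[𝕜] X := fun n => (Q n).1
  let x : ℕ → X := fun n => c (Q n) n - P n (c (Q n) n)
  let g : ℕ → X →L[𝕜] 𝕜 := fun n => f (Q n) n
  let k : ℕ → ℕ := fun n => j (Q n) n
  have hP0 : ∀ y, P 0 y = 0 := fun y => rfl
  have hPs : ∀ n y, P (n + 1) y = P n y + g n y • x n := fun n y => rfl
  have hPx : ∀ n, P n (x n) = 0 := fun n => by simp [x, P, (Q n).2.2]
  have hg1 : ∀ n, g n (x n) = 1 := fun n => hf1 _ _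
  have hgP : ∀ n y, g n (P n y) = 0 := fun n => hf0 _ _
  have hpk : ∀ n, ∀ i < k n, ∀ y, p i (y - P n y) = 0 := fun n => hj _ _
  have hgk : ∀ n, ∃ C : ℝ, ∀ y, ‖g n y‖ ≤ C * p (k n) (y - P n y) := fun n => hC _ _
  have hpx : ∀ n, ∀ i < k n, p i (x n) = 0 := fun n i hi => hpk n i hi _
  clear_value g k
  have hPfix : ∀ m n, m < n → P n (x m) = x m := fun m n hmn => by
    induction n, hmn using Nat.le_induction with
    | base => simp [hPs, hPx, hg1]
    | succ n _ ih => rw [hPs, ih, ← ih, hgP, zero_smul, add_zero, ih]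
  have hgfix : ∀ m n, m < n → ∀ y, g m (P n y) = g m y := fun m n hmn => by
    induction n, hmn using Nat.le_induction with
    | base => intro y; simp [hPs, hgP, hg1]
    | succ n _ ih => intro y; rw [hPs, map_add, ih, map_smul, ← ih (x n), hPx]; simp
  have hPmem : ∀ n y, P n y ∈ Submodule.span 𝕜 (Set.range x) := fun n y => by
    induction n with
    | zero => rw [hP0]; exact zero_mem _
    | succ n ih =>
      rw [hPs]
      exact add_mem ih (Submodule.smul_mem _ _ (Submodule.subset_span ⟨n, rfl⟩))
  -- If the index dropped, its seminorm would vanish on the range of `1 - P n`, and the bound on `g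
  -- (n + 1)` would give `1 ≤ 0` at `x (n + 1)`.
  have hkmono : Monotone k := monotone_nat_of_le_succ fun n => by
    by_contra! hlt
    obtain ⟨C, hC⟩ := hgk (n + 1)
    have h1 := hC (x (n + 1))
    have h0 : p (k (n + 1)) (x (n + 1) - P (n + 1) (x (n + 1))) = 0 := by
      rw [hPs, ← sub_sub]
      refine le_antisymm ((map_sub_le_add _ _ _).trans ?_) (apply_nonneg _ _)
      rw [hpk n _ hlt, map_smul_eq_mul, hpx n _ hlt]
      simp
    rw [h0, hg1] at h1
    norm_num at h1
  have hPbound : ∀ n i, (∀ m < n, ∃ C : ℝ, ∀ y, ‖g m y‖ ≤ C * p i y) →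
      ∃ C : ℝ, ∀ y, p i (y - P n y) ≤ C * p i y := fun n i => by
    induction n with
    | zero => intro _; exact ⟨1, fun y => by simp [hP0]⟩
    | succ n ih =>
      intro h
      obtain ⟨C, hC⟩ := ih fun m hm => h m (hm.trans n.lt_succ_self)
      obtain ⟨D, hD⟩ := h n n.lt_succ_self
      refine ⟨C + D * p i (x n), fun y => ?_⟩
      rw [hPs, ← sub_sub]
      refine (map_sub_le_add _ _ _).trans ?_
      rw [map_smul_eq_mul]
      nlinarith [hC y, mul_le_mul_of_nonneg_right (hD y) (apply_nonneg (p i) (x n))]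
  have hgbound : ∀ n i, k n ≤ i → ∃ C : ℝ, ∀ y, ‖g n y‖ ≤ C * p i y := fun n => by
    have key : ∃ C : ℝ, 0 ≤ C ∧ ∀ y, ‖g n y‖ ≤ C * p (k n) y := by
      induction n using Nat.strong_induction_on with
      | _ n ih =>
        obtain ⟨D, hD⟩ := hPbound n (k n) fun m hm => by
          obtain ⟨C, hC0, hC⟩ := ih m hm
          exact ⟨C, fun y => (hC y).trans
            (mul_le_mul_of_nonneg_left (hp.monotone (hkmono hm.le) y) hC0)⟩
        obtain ⟨C, hC⟩ := hgk n
        refine ⟨|C| * |D|, by positivity, fun y => (hC y).trans ?_⟩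
        rw [mul_assoc]
        refine mul_le_mul (le_abs_self C) ((hD y).trans ?_) (apply_nonneg _ _) (abs_nonneg C)
        exact mul_le_mul_of_nonneg_right (le_abs_self D) (apply_nonneg _ _)
    intro i hi
    obtain ⟨C, hC0, hC⟩ := key
    exact ⟨C, fun y => (hC y).trans (mul_le_mul_of_nonneg_left (hp.monotone hi y) hC0)⟩
  refine ⟨x, g, hg1, fun m n hmn => ?_, ?_, fun i => ?_⟩
  · rcases hmn.lt_or_gt with h | h
    · rw [← hgfix m n h, hPx, map_zero]
    · rw [← hPfix n m h, hgP]
  · refine dense_iff_inter_open.2 fun V hV hne => ?_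
    obtain ⟨n, hn⟩ := hOV V hV hne
    refine ⟨c (Q n) n, hn (hcO _ _), ?_⟩
    have : c (Q n) n = x n + P n (c (Q n) n) := by simp [x]
    rw [this]
    exact add_mem (Submodule.subset_span ⟨n, rfl⟩) (hPmem _ _)
  -- Either `p i` controls every functional, or some `k N` exceeds `i`. In that case `p i` kills `x
  -- n` for `n ≥ N`, and `p (k N)` controls `g (n + 1)` for `n < N`.
  · by_cases h : ∀ n, k n ≤ i
    · exact ⟨i, fun n => Or.inr (hgbound _ _ (h _))⟩
    · push Not at h
      obtain ⟨N, hN⟩ := h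
      refine ⟨k N, fun n => ?_⟩
      rcases le_or_gt N n with hn | hn
      · exact Or.inl (hpx n i (hN.trans_le (hkmono hn)))
      · exact Or.inr (hgbound _ _ (hkmono hn))

end Biorthogonal

/-! ### The weighted shift and its mixing property. -/

section Existence

variable {𝕜 : Type*} [RCLike 𝕜] {X : Type*} [AddCommGroup X] [Module 𝕜 X] [UniformSpace X]
  [IsUniformAddGroup X] [CompleteSpace X]

theorem IsFundamentalSequence.summable {p : ℕ → Seminorm 𝕜 X}
    (hp : IsFundamentalSequence p) {a : ℕ → X} (ha : ∀ i, Summable fun n => p i (a n)) :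
    Summable a := by
  rw [summable_iff_vanishing]
  intro V hV
  obtain ⟨i, hi⟩ := hp.exists_ball_subset V hV
  obtain ⟨s, hs⟩ := summable_iff_vanishing.1 (ha i) (Set.Iio 1) (Iio_mem_nhds one_pos)
  refine ⟨s, fun t ht => hi ?_⟩
  rw [Seminorm.mem_ball_zero]
  exact (Finset.le_sum_of_subadditive (p i) (map_zero _).le (map_add_le_add (p i)) t a).trans_lt
    (hs t ht)

/-- A series of rank one operators converges for small weights, if the seminorms which do not kill
the vectors are linked to seminorms which control the functionals. -/
theorem IsFundamentalSequence.exists_summable_weights {p : ℕ → Seminorm 𝕜 X}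
    (hp : IsFundamentalSequence p) {u : ℕ → X} {g : ℕ → X →L[𝕜] 𝕜}
    (hlink : ∀ i, ∃ l, ∀ n, p i (u n) = 0 ∨ ∃ C : ℝ, ∀ y, ‖g n y‖ ≤ C * p l y) :
    ∃ w : ℕ → 𝕜, (∀ n, w n ≠ 0) ∧ ∀ y, Summable fun n => (w n * g n y) • u n := by
  -- Diagonal choice: each weight meets finitely many constraints, and each pair `(i, l)` is covered
  -- for all large `n`.
  have hw : ∀ n, ∃ w : ℝ, 0 < w ∧ ∀ i ∈ Finset.range (n + 1), ∀ l ∈ Finset.range (n + 1),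
      (p i (u n) = 0 ∨ ∃ C : ℝ, ∀ y, ‖g n y‖ ≤ C * p l y) →
        ∀ y, w * ‖g n y‖ * p i (u n) ≤ (1 / 2) ^ n * p l y := fun n => by
    have hpos : ∀ᶠ w : ℝ in 𝓝[>] 0, 0 < w := self_mem_nhdsWithin
    refine (hpos.and
      ((eventually_all_finset _).2 fun i _ => (eventually_all_finset _).2 fun l _ => ?_)).exists
    by_cases h : p i (u n) = 0
    · exact Eventually.of_forall fun w _ y => by rw [h, mul_zero]; positivity
    by_cases hC : ∃ C : ℝ, ∀ y, ‖g n y‖ ≤ C * p l y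
    · obtain ⟨C, hC⟩ := hC
      have ht : Tendsto (fun w : ℝ => w * C * p i (u n)) (𝓝[>] 0) (𝓝 0) := by
        have : Continuous fun w : ℝ => w * C * p i (u n) := by fun_prop
        simpa using (this.tendsto 0).mono_left nhdsWithin_le_nhds
      filter_upwards [ht.eventually (Iio_mem_nhds (by positivity : (0 : ℝ) < (1 / 2) ^ n)),
        self_mem_nhdsWithin] with w hw (hw0 : 0 < w) _ y
      calc w * ‖g n y‖ * p i (u n) ≤ w * (C * p l y) * p i (u n) := by
            gcongr
            exact hC y
        _ = w * C * p i (u n) * p l y := by ring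
        _ ≤ (1 / 2) ^ n * p l y := by
            gcongr
    · exact Eventually.of_forall fun w hw => (hw.elim h hC).elim
  choose w hw0 hw using hw
  refine ⟨fun n => (w n : 𝕜), fun n => RCLike.ofReal_ne_zero.2 (hw0 n).ne', fun y => ?_⟩
  refine hp.summable fun i => ?_
  obtain ⟨l, hl⟩ := hlink i
  refine Summable.of_norm_bounded_eventually_nat (summable_geometric_two.mul_right (p l y)) ?_
  filter_upwards [eventually_ge_atTop i, eventually_ge_atTop l] with n hi hl'
  rw [Real.norm_of_nonneg (apply_nonneg _ _), map_smul_eq_mul, norm_mul, RCLike.norm_ofReal,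
    abs_of_pos (hw0 n)]
  exact hw n i (Finset.mem_range_succ_iff.2 hi) l (Finset.mem_range_succ_iff.2 hl') (hl n) y

variable [ContinuousSMul 𝕜 X] [PolynormableSpace 𝕜 X] [T2Space X]
  [(uniformity X).IsCountablyGenerated]

/-- Banach–Steinhaus, applied to the partial sums. -/
theorem exists_continuousLinearMap_hasSum {u : ℕ → X} {g : ℕ → X →L[𝕜] 𝕜}
    (h : ∀ y, Summable fun n => g n y • u n) :
    ∃ N : X →L[𝕜] X, ∀ y, HasSum (fun n => g n y • u n) (N y) := by
  have ht : Tendsto (fun (n : ℕ) (y : X) => (∑ m ∈ Finset.range n, (g m).smulRight (u m)) y) atTop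
      (𝓝 fun y => ∑' n, g n y • u n) := by
    refine tendsto_pi_nhds.2 fun y => ?_
    simpa using (h y).tendsto_sum_tsum_nat
  exact ⟨continuousLinearMapOfTendsto _ ht, fun y => (h y).hasSum⟩

/-- An infinite-dimensional separable Fréchet space carries an operator which is mixing over a
nonzero functional. -/
theorem exists_isMixingOver [TopologicalSpace.SeparableSpace X] (hX : ¬ FiniteDimensional 𝕜 X) :
    ∃ (φ : X →L[𝕜] 𝕜) (T : X →L[𝕜] X) (x : ℕ → X) (w : ℕ → 𝕜), IsMixingOver φ T ∧
      (∀ y, φ (T y) = φ y) ∧ φ (x 0) = 1 ∧ φ (x 1) = 0 ∧ LinearIndependent 𝕜 x ∧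
      (∀ n, w n ≠ 0) ∧ ∀ n, T (x (n + 2)) = x (n + 2) + w n • x (n + 1) := by
  have : SecondCountableTopology X := UniformSpace.secondCountable_of_separable X
  obtain ⟨p, hp⟩ := exists_isFundamentalSequence (𝕜 := 𝕜) (X := X)
  obtain ⟨x, f, hf1, hf0, hd, hlink⟩ := exists_biorthogonal hX hp
  obtain ⟨w, hw0, hw⟩ := hp.exists_summable_weights (u := fun n => x (n + 1))
    (g := fun n => f (n + 2)) fun i => (hlink i).imp fun l hl n => hl (n + 1)
  obtain ⟨N, hN⟩ := exists_continuousLinearMap_hasSum (u := fun n => x (n + 1))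
    (g := fun n => w n • f (n + 2)) hw
  have hNx : ∀ n, N (x (n + 2)) = w n • x (n + 1) := fun n => by
    refine (hN _).unique ?_
    convert hasSum_single n fun m hm => ?_ using 1
    · simp [hf1]
    · simp [hf0 (m + 2) (n + 2) (by omega)]
  have hN0 : ∀ i < 2, N (x i) = 0 := fun i hi => by
    refine (hN _).unique ?_
    convert hasSum_zero using 2 with m
    simp [hf0 (m + 2) i (by omega)]
  have hφN : ∀ y, f 0 (N y) = 0 := fun y => by
    refine ((hN y).mapL (f 0)).unique ?_
    convert hasSum_zero using 2 with m
    simp [hf0 0 (m + 1) (by omega)]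
  have hind : LinearIndependent 𝕜 x := by
    rw [linearIndependent_iff']
    intro s c hc i hi
    have := congrArg (f i) hc
    rw [map_sum, map_zero, Finset.sum_eq_single_of_mem i hi fun j _ hj => by
      simp [hf0 i j hj.symm]] at this
    simpa [hf1] using this
  obtain ⟨Φ, hΦ, hΦr⟩ := exists_linearMap_taylor (T := ContinuousLinearMap.id 𝕜 X + N)
    (fun n => x (n + 1)) w hw0 (by simp [hN0]) (by simp [hNx])
  refine ⟨f 0, ContinuousLinearMap.id 𝕜 X + N, x, w, ?_, by simp [hφN], hf1 0,
    hf0 0 1 zero_ne_one, hind, hw0, by simp [hNx]⟩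
  refine isMixingOver_of_taylor (hf1 0) (by simp [hN0]) Φ hΦ fun y hy => ?_
  refine closure_mono hΦr ?_
  -- Projecting along `x 0` carries the dense span into the span of the later vectors, whose closure
  -- thus contains the kernel of `f 0`.
  have hmaps : ∀ v ∈ Submodule.span 𝕜 (Set.range x),
      v - f 0 v • x 0 ∈ Submodule.span 𝕜 (Set.range fun n => x (n + 1)) := fun v hv => by
    induction hv using Submodule.span_induction with
    | mem v hv =>
      obtain ⟨n, rfl⟩ := hv
      cases n with
      | zero => simp [hf1]
      | succ n =>
        rw [hf0 0 _ (by omega), zero_smul, sub_zero]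
        exact Submodule.subset_span ⟨n, rfl⟩
    | zero => simp
    | add a b _ _ ha hb =>
      convert add_mem ha hb using 1
      rw [map_add, add_smul]; abel
    | smul c a _ ha =>
      convert Submodule.smul_mem _ c ha using 1
      rw [map_smul, smul_eq_mul, mul_smul, smul_sub]
  have := map_mem_closure (f := fun v => v - f 0 v • x 0) (by fun_prop) (hd y) hmaps
  simpa [hy] using this

end Existence

/-! ### Transitivity of `GL(X)` on finite independent families. -/

section Transitivity

variable {𝕜 : Type*} [RCLike 𝕜] {X : Type*} [AddCommGroup X] [Module 𝕜 X]

theorem exists_linearIndependent_mkQ (hX : ¬ FiniteDimensional 𝕜 X) (E : Submodule 𝕜 X)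
    [FiniteDimensional 𝕜 E] (ι : Type*) [Finite ι] :
    ∃ v : ι → X, LinearIndependent 𝕜 (E.mkQ ∘ v) := by
  let b := Module.Basis.ofVectorSpace 𝕜 (X ⧸ E)
  have hinf : Infinite (Module.Basis.ofVectorSpaceIndex 𝕜 (X ⧸ E)) := by
    by_contra h
    rw [not_infinite_iff_finite] at h
    have : Module.Finite 𝕜 (X ⧸ E) := Module.Finite.of_basis b
    exact hX (Module.Finite.of_submodule_quotient E)
  obtain ⟨n, ⟨e⟩⟩ := Finite.exists_equiv_fin ι
  let s : ι → Module.Basis.ofVectorSpaceIndex 𝕜 (X ⧸ E) := fun i => Infinite.natEmbedding _ (e i)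
  have hs : Function.Injective s :=
    (Infinite.natEmbedding _).injective.comp (Fin.val_injective.comp e.injective)
  choose v hv using fun i => E.mkQ_surjective (b (s i))
  exact ⟨v, by
    have : E.mkQ ∘ v = b ∘ s := funext hv
    rw [this]
    exact b.linearIndependent.comp s hs⟩

variable [TopologicalSpace X] [T2Space X] [PolynormableSpace 𝕜 X]

theorem separatingDual_of_polynormableSpace : SeparatingDual 𝕜 X := ⟨fun x hx => by
  obtain ⟨p, hp⟩ := (PolynormableSpace.withSeminorms 𝕜 X).separating_of_T1 x hx
  obtain ⟨f, hf, -⟩ := exists_functional_eq_one_of_seminorm_ne_zero p.2 hp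
  exact ⟨f, by simp [hf]⟩⟩

theorem exists_dual_family {ι : Type*} [Finite ι] [DecidableEq ι] {b : ι → X}
    (hb : LinearIndependent 𝕜 b) :
    ∃ f : ι → X →L[𝕜] 𝕜, ∀ i j, f i (b j) = if i = j then 1 else 0 := by
  have := separatingDual_of_polynormableSpace (𝕜 := 𝕜) (X := X)
  have hsurj := SeparatingDual.dualMap_surjective_iff.2 (hb : Function.Injective _)
  choose f hf using fun i => hsurj (Finsupp.lapply i)
  refine ⟨f, fun i j => ?_⟩
  have := LinearMap.congr_fun (hf i) (Finsupp.single j 1)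
  simpa [Finsupp.single_apply, eq_comm] using this

variable [IsTopologicalAddGroup X] [ContinuousSMul 𝕜 X]

/-- Two jointly independent finite families are exchanged by an involution. -/
theorem exists_continuousLinearEquiv_of_linearIndependent_sumElim {ι : Type*} [Finite ι]
    {u v : ι → X} (h : LinearIndependent 𝕜 (Sum.elim u v)) :
    ∃ J : X ≃L[𝕜] X, ∀ i, J (u i) = v i := by
  classical
  have := Fintype.ofFinite ι
  obtain ⟨f, hf⟩ := exists_dual_family h
  -- `c i` is `1` at `u i` and `-1` at `v i`, so adding `c i y • (v i - u i)` swaps the two; `c i (J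
  -- y) = -c i y` makes `J` an involution.
  let c : ι → X →L[𝕜] 𝕜 := fun i => f (Sum.inl i) - f (Sum.inr i)
  have hu : ∀ i j, c i (u j) = if i = j then 1 else 0 := fun i j => by
    have h1 := hf (Sum.inl i) (Sum.inl j)
    have h2 := hf (Sum.inr i) (Sum.inl j)
    simp only [Sum.elim_inl, Sum.inl.injEq, reduceCtorEq, if_false] at h1 h2
    simp [c, h1, h2]
  have hv : ∀ i j, c i (v j) = if i = j then -1 else 0 := fun i j => by
    have h1 := hf (Sum.inl i) (Sum.inr j)
    have h2 := hf (Sum.inr i) (Sum.inr j)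
    simp only [Sum.elim_inr, Sum.inr.injEq, reduceCtorEq, if_false] at h1 h2
    simp only [c, sub_apply, h1, h2]
    split_ifs <;> simp
  let J : X →L[𝕜] X := ContinuousLinearMap.id 𝕜 X + ∑ i, (c i).smulRight (v i - u i)
  have hJ : ∀ y, J y = y + ∑ i, c i y • (v i - u i) := fun y => by simp [J]
  have hcJ : ∀ i y, c i (J y) = -c i y := fun i y => by
    simp only [hJ, map_add, map_sum, map_smul, map_sub, hu, hv, smul_eq_mul]
    rw [Finset.sum_eq_single i (fun j _ hj => by simp [hj.symm]) (by simp)]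
    simp only [if_true]
    ring
  have hJJ : ∀ y, J (J y) = y := fun y => by
    rw [hJ (J y)]
    simp only [hcJ, neg_smul, Finset.sum_neg_distrib]
    rw [hJ y, add_neg_cancel_right]
  refine ⟨ContinuousLinearEquiv.equivOfInverse J J hJJ hJJ, fun j => ?_⟩
  change J (u j) = v j
  simp [hJ, hu]

/-- The spans of `u` and `v` may meet, so the map passes through a third family independent of both.
-/
theorem exists_continuousLinearEquiv_of_linearIndependent (hX : ¬ FiniteDimensional 𝕜 X)
    {ι : Type*} [Finite ι] {u v : ι → X} (hu : LinearIndependent 𝕜 u)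
    (hv : LinearIndependent 𝕜 v) : ∃ J : X ≃L[𝕜] X, ∀ i, J (u i) = v i := by
  let E := Submodule.span 𝕜 (Set.range u ∪ Set.range v)
  have : FiniteDimensional 𝕜 E :=
    FiniteDimensional.span_of_finite 𝕜 ((Set.finite_range u).union (Set.finite_range v))
  obtain ⟨w, hw⟩ := exists_linearIndependent_mkQ hX E ι
  have key : ∀ u' : ι → X, (∀ i, u' i ∈ E) → LinearIndependent 𝕜 u' →
      LinearIndependent 𝕜 (Sum.elim u' w) := fun u' hmem hu' =>
    LinearIndependent.sumElim_of_quotient (M' := E) (f := fun i => (⟨u' i, hmem i⟩ : E))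
      (LinearIndependent.of_comp E.subtype hu') w hw
  obtain ⟨J, hJ⟩ := exists_continuousLinearEquiv_of_linearIndependent_sumElim
    (key u (fun i => Submodule.subset_span (Or.inl ⟨i, rfl⟩)) hu)
  obtain ⟨K, hK⟩ := exists_continuousLinearEquiv_of_linearIndependent_sumElim
    (key v (fun i => Submodule.subset_span (Or.inr ⟨i, rfl⟩)) hv)
  exact ⟨J.trans K.symm, fun i => by simp [hJ, ← hK]⟩

end Transitivity

/-! ### Interpolation by conjugates and density. -/

section Density

variable {𝕜 : Type*} [RCLike 𝕜] {X : Type*} [AddCommGroup X] [Module 𝕜 X]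

section

variable [TopologicalSpace X]

theorem conj_pow_apply (J : X ≃L[𝕜] X) (T : X →L[𝕜] X) (k : ℕ) (y : X) :
    (((J : X →L[𝕜] X).comp (T.comp (J.symm : X →L[𝕜] X))) ^ k) (J y) = J ((T ^ k) y) := by
  induction k generalizing y with
  | zero => simp
  | succ k ih =>
    rw [pow_succ, pow_succ, mul_apply_eq_comp, mul_apply_eq_comp, ← ih]
    simp

theorem IsMixingOver.conj {φ : X →L[𝕜] 𝕜} {T : X →L[𝕜] X} (h : IsMixingOver φ T)
    (J : X ≃L[𝕜] X) : IsMixingOver (φ.comp (J.symm : X →L[𝕜] X))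
      ((J : X →L[𝕜] X).comp (T.comp (J.symm : X →L[𝕜] X))) := by
  intro x y hxy U hU V hV
  have hpre : ∀ z, ∀ W ∈ 𝓝 z, J ⁻¹' W ∈ 𝓝 (J.symm z) := fun z W hW =>
    J.continuous.continuousAt.preimage_mem_nhds (by simpa using hW)
  filter_upwards [h _ _ hxy _ (hpre x U hU) _ (hpre y V hV)] with k ⟨u, hu, hk⟩
  exact ⟨J u, hu, by rw [conj_pow_apply]; exact hk⟩

/-- A set of operators which, up to an arbitrarily small perturbation, interpolates every operator
on every finite independent family is dense for the strong operator topology. -/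
theorem isSOTDense_of_interpolation [IsTopologicalAddGroup X] [ContinuousSMul 𝕜 X]
    (hX : ¬ FiniteDimensional 𝕜 X) {S : Set (X →L[𝕜] X)}
    (h : ∀ (n : ℕ) (a b : Fin n → X), LinearIndependent 𝕜 (Sum.elim a b) →
      ∃ T ∈ S, ∀ i, T (a i) = b i) : IsSOTDense S := by
  intro A
  rw [mem_closure_iff_nhds]
  intro U hU
  rw [(PointwiseConvergenceCLM.isEmbedding_coeFn (RingHom.id 𝕜) X X).nhds_eq_comap,
    mem_comap] at hU
  obtain ⟨t, ht, htU⟩ := hU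
  rw [nhds_pi, Filter.mem_pi'] at ht
  obtain ⟨I, s, hs, hst⟩ := ht
  let E₀ := Submodule.span 𝕜 (I : Set X)
  let A' : X →L[𝕜] X := A
  have hE₀ : FiniteDimensional 𝕜 E₀ := FiniteDimensional.span_finset 𝕜 I
  let a := Module.finBasis 𝕜 E₀
  let E := E₀ ⊔ E₀.map A'.toLinearMap
  -- Adding `ε • v i` to the image of the basis vector `a i` puts the images in general position
  -- with respect to the basis.
  obtain ⟨v, hv⟩ := exists_linearIndependent_mkQ hX E (Fin (Module.finrank 𝕜 E₀))
  let R : E₀ →ₗ[𝕜] X := a.constr 𝕜 v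
  have hR : ∀ i, R (a i) = v i := fun i => a.constr_basis ..
  have hsmall : ∀ᶠ ε : 𝕜 in 𝓝[≠] 0, ∀ x : I,
      A' x + ε • R ⟨x, Submodule.subset_span x.2⟩ ∈ s x := by
    refine eventually_all.2 fun x => ?_
    have hc : Continuous fun ε : 𝕜 => A' x + ε • R ⟨x, Submodule.subset_span x.2⟩ := by fun_prop
    have ht := (hc.tendsto 0).mono_left (nhdsWithin_le_nhds (s := {0}ᶜ))
    rw [zero_smul, add_zero] at ht
    exact ht.eventually (hs x)
  obtain ⟨ε, hε, hε0⟩ := (hsmall.and self_mem_nhdsWithin).exists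
  have hmk : ∀ i, E.mkQ (A' (a i) + ε • v i) = ε • E.mkQ (v i) := fun i => by
    have : E.mkQ (A' (a i)) = 0 :=
      (Submodule.Quotient.mk_eq_zero E).2 (Submodule.mem_sup_right ⟨_, (a i).2, rfl⟩)
    rw [map_add, this, zero_add, map_smul]
  have hind : LinearIndependent 𝕜
      (Sum.elim (fun i => (a i : X)) fun i => A' (a i) + ε • v i) := by
    refine LinearIndependent.sumElim_of_quotient (M' := E)
      (f := fun i => (⟨a i, Submodule.mem_sup_left (a i).2⟩ : E)) ?_ _ ?_
    · exact LinearIndependent.of_comp E.subtype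
        (a.linearIndependent.map' E₀.subtype E₀.ker_subtype)
    · have hmk' : E.mkQ ∘ (fun i => A' (a i) + ε • v i) =
          (fun _ : Fin (Module.finrank 𝕜 E₀) => Units.mk0 ε hε0) • (E.mkQ ∘ v) := funext hmk
      change LinearIndependent 𝕜 (E.mkQ ∘ fun i => A' (a i) + ε • v i)
      rw [hmk']
      exact hv.units_smul _
  obtain ⟨T, hTS, hT⟩ := h _ _ _ hind
  refine ⟨_, htU (hst fun x hx => ?_), T, hTS, rfl⟩
  have hTR : T.toLinearMap ∘ₗ E₀.subtype = A'.toLinearMap ∘ₗ E₀.subtype + ε • R :=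
    a.ext fun i => by simp [hT, hR]
  have := LinearMap.congr_fun hTR ⟨x, Submodule.subset_span hx⟩
  change T x = A' x + ε • R ⟨x, Submodule.subset_span hx⟩ at this
  change T x ∈ s x
  rw [this]
  exact hε ⟨x, hx⟩

end

variable [UniformSpace X] [IsUniformAddGroup X] [ContinuousSMul 𝕜 X] [PolynormableSpace 𝕜 X]
    [T2Space X] [(uniformity X).IsCountablyGenerated] [CompleteSpace X]
    [TopologicalSpace.SeparableSpace X]

theorem exists_quasiRigid_interpolation (hX : ¬ FiniteDimensional 𝕜 X) {n : ℕ} {a b : Fin n → X}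
    (hab : LinearIndependent 𝕜 (Sum.elim a b)) :
    ∃ T : X →L[𝕜] X, (IsQuasiRigid T ∧ ∃ G : Set (X →L[𝕜] X), IsIdentityCollection T G ∧
      {ContinuousLinearMap.id 𝕜 X} ⊂ G ∧ G ⊂ generalLinear 𝕜 X) ∧ ∀ i, T (a i) = b i := by
  obtain ⟨φ, T, x, w, hmix, hφT, hφ0, hφ1, hx, hw, hT⟩ := exists_isMixingOver (𝕜 := 𝕜) hX
  -- With spacing two, the pairs `z i`, `T (z i)` involve disjoint pairs of the `x j`, so they are
  -- jointly independent.
  let z : Fin n → X := fun i => x (2 * i + 2)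
  have hz : LinearIndependent 𝕜 (Sum.elim z fun i => T (z i)) := by
    let σ : Fin n ⊕ Fin n → ℕ := Sum.elim (fun i => 2 * i + 2) fun i => 2 * i + 1
    have hσ : Function.Injective σ := by
      rintro (i | i) (j | j) hij <;> simp only [σ, Sum.elim_inl, Sum.elim_inr] at hij <;>
        first | omega | (congr 1; omega)
    have hxσ := Fintype.linearIndependent_iff.1 (hx.comp σ hσ)
    refine Fintype.linearIndependent_iff.2 fun c hc => ?_
    have key := hxσ (Sum.elim (fun i => c (Sum.inl i) + c (Sum.inr i))
      fun i => c (Sum.inr i) * w (2 * i)) <| by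
        rw [Fintype.sum_sum_type] at hc ⊢
        simp only [Sum.elim_inl, Sum.elim_inr, Function.comp_apply, z, hT, σ, smul_add, add_smul,
          mul_smul, Finset.sum_add_distrib] at hc ⊢
        rw [← hc]
        abel
    have hr : ∀ i, c (Sum.inr i) = 0 := fun i =>
      (mul_eq_zero.1 (key (Sum.inr i))).resolve_right (hw _)
    rintro (i | i)
    · simpa [hr] using key (Sum.inl i)
    · exact hr i
  obtain ⟨J, hJ⟩ := exists_continuousLinearEquiv_of_linearIndependent hX hz hab
  refine ⟨(J : X →L[𝕜] X).comp (T.comp (J.symm : X →L[𝕜] X)),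
    (hmix.conj J).exists_identityCollection (e := J (x 0)) (z := J (x 1)) (fun y => ?_) ?_ ?_ ?_,
    fun i => ?_⟩
  · simp [hφT]
  · simpa using hφ0
  · simpa using hx.ne_zero 1
  · simpa using hφ1
  · have h1 : a i = J (z i) := (hJ (Sum.inl i)).symm
    have h2 : J (T (z i)) = b i := hJ (Sum.inr i)
    simp [h1, h2]

end Density

end QuasiRigidDensity

theorem theorem3p21 {𝕜 : Type*} [RCLike 𝕜] {X : Type*} [AddCommGroup X] [Module 𝕜 X]
    [UniformSpace X] [IsUniformAddGroup X] [ContinuousSMul 𝕜 X] [PolynormableSpace 𝕜 X]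
    [T2Space X] [(uniformity X).IsCountablyGenerated] [CompleteSpace X]
    [TopologicalSpace.SeparableSpace X] (hX : ¬ FiniteDimensional 𝕜 X) :
    QuasiRigidDensity.IsSOTDense
      {T : X →L[𝕜] X | QuasiRigidDensity.IsQuasiRigid T ∧
        ∃ G : Set (X →L[𝕜] X), QuasiRigidDensity.IsIdentityCollection T G ∧
          {ContinuousLinearMap.id 𝕜 X} ⊂ G ∧ G ⊂ QuasiRigidDensity.generalLinear 𝕜 X} :=
  QuasiRigidDensity.isSOTDense_of_interpolation hX fun _ _ _ hab =>
    QuasiRigidDensity.exists_quasiRigid_interpolation hX hab
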